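/- **Model.** An instance consists of a finite directed graph $G=(V,E)$ (loops allowed) with $n\ge 1$ vertices, a target set $T\subseteq V$ and a starting vertex $s\in V$. The Büchi (liveness) problem asks whether some infinite path of $G$ that starts in $s$ visits some vertex of $T$ infinitely often. A symbolic algorithm knows $V$, $T$ and $s$, but has access to $E$ only through the one-step operations $\mathrm{Pre}(S)=\{v : \exists u\in S,\ (v,u)\in E\}$ and $\mathrm{Post}(S)=\{v : \exists u\in S,\ (u,v)\in E\}$, applied to sets $S\subseteq V$ that may depend on the earlier answers; all other computation, in particular the basic set operations, is free. A probabilistic symbolic algorithm is a random choice (over any probability space) of a deterministic terminating one; a deterministic algorithm is the special case of a one-point space. An algorithm solves the Büchi problem with error $\varepsilon$ on a class of instances if on each instance of the class its answer is wrong with probability at most $\varepsilon$. Its cost on an instance is the expected number of one-step operations (for a deterministic algorithm, the number of them); a lower bound on it is also one on the worst case over the random choices. Let $D=D(G)$ be the largest finite distance in $G$, $\mathrm{SCCs}(G)$ the set of strongly connected components (including single vertices that lie on no cycle), and $D_C$ the diameter of the subgraph induced on the component $C$. **Theorem.** For every $0\le\varepsilon<1/2$ there is a constant $c>0$, depending only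 on $\varepsilon$, such that the following holds for every (probabilistic with error $\varepsilon$, or deterministic) symbolic algorithm. 1. ($\Omega(n)$ even for constant diameter) If it solves the Büchi problem on all instances with $D=1$, then for every $n\ge 2$ there is an instance with $n$ vertices and $D=1$ on which its cost is at least $c\,n$. 2. ($\Omega(D)$ even for $|T|=1$) If it solves the Büchi problem on all instances with $|T|=1$, then for every $d\ge 0$ there is an instance with $|T|=1$ and $D=d$ on which its cost is at least $c\,d$. 3. ($\Omega(|T|)$ even for constant diameter) If it solves the Büchi problem on all instances with $D=1$, then for every $t\ge 0$ there is an instance with $|T|=t$ and $D=1$ on which its cost is at least $c\,t$. 4. ($\Omega(|T|+D)$) If it solves the Büchi problem on all instances, then for all $t,d\ge 1$ there is an instance with $|T|=t$ and $D=d$ on which its cost is at least $c\,(t+d)$. 5. ($\Omega(|\mathrm{SCCs}(G)|+\sum_C D_C)$) If it solves the Büchi problem on all instances, then for all $p\ge 1$, $q\ge 0$ there is an instance with $|\mathrm{SCCs}(G)|=p$ and $\sum_{C\in \mathrm{SCCs}(G)}D_C=q$ on which its cost is at least $c\,(p+q)$. -/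

import Mathlib

open MeasureTheory Filter
open scoped ENNReal

namespace SymbolicBuchi

section Graphs

variable {V : Type*}

/-- `Pre(S)`: the vertices with an edge to some vertex of `S`. -/
def Pre (G : Digraph V) (S : Set V) : Set V := {v | ∃ s ∈ S, G.Adj v s}

/-- `Post(S)`: the vertices with an edge from some vertex of `S`. -/
def Post (G : Digraph V) (S : Set V) : Set V := {v | ∃ s ∈ S, G.Adj s v}

/-- There is a path with exactly `k` edges from `u` to `v`. -/
def HasPath (G : Digraph V) : ℕ → V → V → Prop
  | 0, u, v => u = v
  | k + 1, u, v => ∃ w, G.Adj u w ∧ HasPath G k w v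

/-- `u` can reach `v`, and the smallest number of edges of a path from `u` to `v` is `k`. -/
def IsDist (G : Digraph V) (u v : V) (k : ℕ) : Prop :=
  IsLeast {j | HasPath G j u v} k

/-- The diameter: the largest finite distance in the graph. (On a finite vertex set the set of
finite distances is bounded, and it contains `0` as soon as there is a vertex.) -/
noncomputable def diam (G : Digraph V) : ℕ :=
  sSup {k | ∃ u v, IsDist G u v k}

/-- `u` can reach `v` (by a path with any number of edges, possibly none). -/
def Reaches (G : Digraph V) (u v : V) : Prop := ∃ k, HasPath G k u v

/-- The strongly connected component of `v`. -/
def sccOf (G : Digraph V) (v : V) : Set V := {u | Reaches G u v ∧ Reaches G v u}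

/-- The set of all strongly connected components (single vertices on no cycle included). -/
def sccs (G : Digraph V) : Set (Set V) := Set.range (sccOf G)

/-- The subgraph induced on a set of vertices. -/
def induce (G : Digraph V) (C : Set V) : Digraph C where
  Adj u v := G.Adj u v

/-- The sum of the diameters of the strongly connected components. -/
noncomputable def sumSccDiam (G : Digraph V) : ℕ :=
  ∑ᶠ C ∈ sccs G, diam (induce G C)

/-- The Büchi objective: some infinite path from `s` visits some vertex of `T` infinitely often. -/
def BuchiWinning (G : Digraph V) (T : Finset V) (s : V) : Prop :=
  ∃ p : ℕ → V, p 0 = s ∧ (∀ i, G.Adj (p i) (p (i + 1))) ∧ ∃ v ∈ T, ∃ᶠ i in atTop, p i = v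

end Graphs

/-- The behaviour of a deterministic symbolic algorithm on a known vertex set `V` with an unknown
edge relation. The only access to the edges is by the operations `Pre` and `Post`, which may be
applied to any set of vertices and whose answer is a set of vertices. All other work (the basic
set operations, tests, any non-symbolic computation, the storage of any number of sets)
is free: it is contained in the choice of the next operation as a function of all earlier
answers. Every run terminates. -/
inductive SymProg (V : Type) : Type
  | halt (answer : Bool) : SymProg V
  | pre (S : Set V) (next : Set V → SymProg V) : SymProg V
  | post (S : Set V) (next : Set V → SymProg V) : SymProg V

/-- The answer of the run on the graph `G`. -/
def SymProg.answer {V : Type} (G : Digraph V) : SymProg V → Bool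
  | .halt b => b
  | .pre S next => (next (Pre G S)).answer G
  | .post S next => (next (Post G S)).answer G

/-- The number of one-step operations in the run on the graph `G`. -/
def SymProg.ops {V : Type} (G : Digraph V) : SymProg V → ℕ
  | .halt _ => 0
  | .pre S next => (next (Pre G S)).ops G + 1
  | .post S next => (next (Post G S)).ops G + 1

/-- An instance: a directed graph on `n` vertices, a target set and a starting vertex. -/
structure Instance where
  /-- The number of vertices. -/
  n : ℕ
  /-- The graph (loops are allowed). -/
  G : Digraph (Fin n)
  /-- The target set. -/
  T : Finset (Fin n)
  /-- The starting vertex. -/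
  s : Fin n

/-- A symbolic decision algorithm with random source `Ω`. It is given the vertex set, the target
set and the starting vertex explicitly; the edges only through one-step operations. A deterministic
algorithm is the case in which `Ω` has one point. -/
structure SymbolicAlg (Ω : Type*) [MeasurableSpace Ω] where
  /-- The run for the outcome `ω` of the random source. -/
  prog : Ω → (n : ℕ) → Finset (Fin n) → Fin n → SymProg (Fin n)
  measurable_answer : ∀ I : Instance, Measurable fun ω => (prog ω I.n I.T I.s).answer I.G
  measurable_ops : ∀ I : Instance, Measurable fun ω => (prog ω I.n I.T I.s).ops I.G

variable {Ω : Type*} [MeasurableSpace Ω]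

/-- On every instance of the class `𝒞`, the algorithm decides the Büchi objective with error
probability at most `ε`. -/
def SymbolicAlg.SolvesBuchi (A : SymbolicAlg Ω) (μ : Measure Ω) (ε : ℝ) (𝒞 : Set Instance) : Prop :=
  ∀ I ∈ 𝒞, μ {ω | ¬ ((A.prog ω I.n I.T I.s).answer I.G = true ↔ BuchiWinning I.G I.T I.s)}
    ≤ ENNReal.ofReal ε

/-- The expected number of one-step operations on the instance `I` (at most the worst case over
the random choices, and equal to the number of operations for a deterministic algorithm). -/
noncomputable def SymbolicAlg.expectedOps (A : SymbolicAlg Ω) (μ : Measure Ω) (I : Instance) : ℝ≥0∞ :=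
  ∫⁻ ω, ((A.prog ω I.n I.T I.s).ops I.G : ℝ≥0∞) ∂μ

end SymbolicBuchi

open SymbolicBuchi

/-! This is an adversary argument. Take a graph `G₀` and `m` graphs whose correct answers are all
opposite to that of `G₀`, such that no single operation separates `G₀` from more than one of them. A
run on `G₀` with `k` operations then answers alike on all but at most `k` of the `m` graphs. Error
at most `ε` on both sides forces each graph to be separated with probability at least `1 - 2ε`, and
summing gives expected cost at least `(1 - 2ε) m` on `G₀` (`card_distinguished_le`,
`le_expectedOps_of_family`).

Two families hide one edge well enough. In a loop-free transitive chain no infinite path exists. A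
loop at a target `k` creates a winning path, but `Pre` notices it only if `k` is the largest chain
vertex of the queried set, and `Post` only if it is the smallest. In a ladder with all backward
edges the top is reached from the foot. Deleting `k → k + 1` destroys this, but is seen only if `k +
1` is the least queried ladder vertex (`Pre`) or `k` the greatest (`Post`).

The chain supplies many targets and singleton components at diameter at most 1; the ladder supplies
one component of large diameter. Their disjoint union, started in the part with the larger
parameter, gives the bounds on sums. -/

namespace SymbolicBuchi

/-! ### The adversary bound. -/

section LowerBound

/-- If every single operation separates `G₀` from at most one graph of a family, then a run on `G₀`
with `k` operations separates `G₀` from at most `k` graphs of the family. -/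
theorem card_distinguished_le {V : Type} {m : ℕ} (G₀ : Digraph V) (G : Fin m → Digraph V)
    (hpre : ∀ S i j, Pre (G i) S ≠ Pre G₀ S → Pre (G j) S ≠ Pre G₀ S → i = j)
    (hpost : ∀ S i j, Post (G i) S ≠ Post G₀ S → Post (G j) S ≠ Post G₀ S → i = j)
    (P : SymProg V) :
    (Finset.univ.filter fun i => P.answer (G i) ≠ P.answer G₀).card ≤ P.ops G₀ := by
  classical
  induction P with
  | halt b => simp [SymProg.answer]
  | pre S next ih =>
    have hsub : (Finset.univ.filter fun i =>
        (SymProg.pre S next).answer (G i) ≠ (SymProg.pre S next).answer G₀) ⊆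
        (Finset.univ.filter fun i =>
          (next (Pre G₀ S)).answer (G i) ≠ (next (Pre G₀ S)).answer G₀) ∪
        (Finset.univ.filter fun i => Pre (G i) S ≠ Pre G₀ S) := by
      intro i hi
      rw [Finset.mem_union, Finset.mem_filter, Finset.mem_filter]
      have h : (next (Pre (G i) S)).answer (G i) ≠ (next (Pre G₀ S)).answer G₀ :=
        (Finset.mem_filter.1 hi).2
      by_cases h' : Pre (G i) S = Pre G₀ S
      · exact Or.inl ⟨Finset.mem_univ _, h' ▸ h⟩
      · exact Or.inr ⟨Finset.mem_univ _, h'⟩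
    -- Graphs agreeing with `G₀` on this operation continue with the same program; at most one graph
    -- disagrees, and this operation pays for it.
    refine (Finset.card_le_card hsub).trans ((Finset.card_union_le _ _).trans ?_)
    refine Nat.add_le_add (ih _) (Finset.card_le_one.2 fun i hi j hj => ?_)
    exact hpre S i j (by simpa using hi) (by simpa using hj)
  | post S next ih =>
    have hsub : (Finset.univ.filter fun i =>
        (SymProg.post S next).answer (G i) ≠ (SymProg.post S next).answer G₀) ⊆
        (Finset.univ.filter fun i =>
          (next (Post G₀ S)).answer (G i) ≠ (next (Post G₀ S)).answer G₀) ∪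
        (Finset.univ.filter fun i => Post (G i) S ≠ Post G₀ S) := by
      intro i hi
      rw [Finset.mem_union, Finset.mem_filter, Finset.mem_filter]
      have h : (next (Post (G i) S)).answer (G i) ≠ (next (Post G₀ S)).answer G₀ :=
        (Finset.mem_filter.1 hi).2
      by_cases h' : Post (G i) S = Post G₀ S
      · exact Or.inl ⟨Finset.mem_univ _, h' ▸ h⟩
      · exact Or.inr ⟨Finset.mem_univ _, h'⟩
    refine (Finset.card_le_card hsub).trans ((Finset.card_union_le _ _).trans ?_)
    refine Nat.add_le_add (ih _) (Finset.card_le_one.2 fun i hi j hj => ?_)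
    exact hpost S i j (by simpa using hi) (by simpa using hj)

/-- The adversary bound: if every operation separates `G₀` from at most one of `m` graphs on which
the correct answer differs from that on `G₀`, the expected number of operations on `G₀` is at least
`(1 - 2ε) m`. -/
theorem le_expectedOps_of_family {Ω : Type*} [MeasurableSpace Ω] (μ : Measure Ω)
    [IsProbabilityMeasure μ] (A : SymbolicAlg Ω) {ε : ℝ} (hε : 0 ≤ ε) {𝒞 : Set Instance}
    (hA : A.SolvesBuchi μ ε 𝒞) {n m : ℕ} (G₀ : Digraph (Fin n)) (G : Fin m → Digraph (Fin n))
    (T : Finset (Fin n)) (s : Fin n)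
    (hpre : ∀ S i j, Pre (G i) S ≠ Pre G₀ S → Pre (G j) S ≠ Pre G₀ S → i = j)
    (hpost : ∀ S i j, Post (G i) S ≠ Post G₀ S → Post (G j) S ≠ Post G₀ S → i = j)
    (h₀ : (⟨n, G₀, T, s⟩ : Instance) ∈ 𝒞) (h : ∀ i, (⟨n, G i, T, s⟩ : Instance) ∈ 𝒞)
    (hflip : ∀ i, BuchiWinning (G i) T s ↔ ¬ BuchiWinning G₀ T s) :
    ENNReal.ofReal ((1 - 2 * ε) * m) ≤ A.expectedOps μ ⟨n, G₀, T, s⟩ := by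
  let B : Fin m → Set Ω := fun i =>
    {ω | (A.prog ω n T s).answer (G i) ≠ (A.prog ω n T s).answer G₀}
  have hB : ∀ i, MeasurableSet (B i) := fun i =>
    (measurableSet_eq_fun (A.measurable_answer ⟨n, G i, T, s⟩)
      (A.measurable_answer ⟨n, G₀, T, s⟩)).compl
  have hμB : ∀ i, ENNReal.ofReal (1 - 2 * ε) ≤ μ (B i) := by
    intro i
    -- Outside `B i` the two answers agree while the correct ones differ, so one of the two runs
    -- errs.
    have hcov : (Set.univ : Set Ω) ⊆ B i ∪
        ({ω | ¬ ((A.prog ω n T s).answer (G i) = true ↔ BuchiWinning (G i) T s)} ∪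
          {ω | ¬ ((A.prog ω n T s).answer G₀ = true ↔ BuchiWinning G₀ T s)}) := by
      intro ω _
      have := hflip i
      by_cases hω : (A.prog ω n T s).answer (G i) = (A.prog ω n T s).answer G₀
      · right
        simp only [Set.mem_union, Set.mem_ofPred_eq, hω, this]
        tauto
      · exact Or.inl hω
    have h1 : (1 : ℝ≥0∞) ≤ μ (B i) + (ENNReal.ofReal ε + ENNReal.ofReal ε) := by
      rw [← measure_univ (μ := μ)]
      refine (measure_mono hcov).trans ((measure_union_le _ _).trans ?_)
      gcongr
      exact (measure_union_le _ _).trans (add_le_add (hA _ (h i)) (hA _ h₀))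
    rw [ENNReal.ofReal_sub _ (by positivity), ENNReal.ofReal_one, two_mul,
      ENNReal.ofReal_add hε hε]
    exact tsub_le_iff_right.2 h1
  calc ENNReal.ofReal ((1 - 2 * ε) * m)
      = ∑ _i : Fin m, ENNReal.ofReal (1 - 2 * ε) := by
        rw [ENNReal.ofReal_mul' (by positivity), ENNReal.ofReal_natCast]
        simp [mul_comm]
    _ ≤ ∑ i, μ (B i) := Finset.sum_le_sum fun i _ => hμB i
    _ = ∫⁻ ω, ∑ i, (B i).indicator 1 ω ∂μ := by
        rw [lintegral_finsetSum _ fun i _ => measurable_one.indicator (hB i)]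
        simp [lintegral_indicator_one (hB _)]
    _ ≤ A.expectedOps μ ⟨n, G₀, T, s⟩ := by
        refine lintegral_mono fun ω => ?_
        have := card_distinguished_le G₀ G hpre hpost (A.prog ω n T s)
        calc ∑ i, (B i).indicator (1 : Ω → ℝ≥0∞) ω
            = ((Finset.univ.filter fun i =>
                (A.prog ω n T s).answer (G i) ≠ (A.prog ω n T s).answer G₀).card : ℝ≥0∞) := by
              rw [← Finset.sum_boole]
              exact Finset.sum_congr rfl fun i _ => by simp [B, Set.indicator_apply]
          _ ≤ _ := by exact_mod_cast this

end LowerBound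

/-! ### Paths and diameters in general digraphs. -/

section Paths

variable {V : Type*}

theorem diam_eq {G : Digraph V} {d : ℕ} (hd : ∃ u v, IsDist G u v d)
    (hle : ∀ u v k, HasPath G k u v → ∃ j ≤ d, HasPath G j u v) : diam G = d := by
  refine IsGreatest.csSup_eq ⟨hd, ?_⟩
  rintro k ⟨u, v, hk⟩
  obtain ⟨j, hj, hp⟩ := hle u v k hk.1
  exact (hk.2 hp).trans hj

theorem diam_eq_zero_of_subsingleton [Subsingleton V] [Nonempty V] (G : Digraph V) :
    diam G = 0 := by
  obtain ⟨v⟩ := ‹Nonempty V›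
  exact diam_eq ⟨v, v, rfl, fun _ _ => Nat.zero_le _⟩
    fun u w _ _ => ⟨0, le_rfl, Subsingleton.elim u w⟩

theorem HasPath.invariant {G : Digraph V} {p : V → Prop} (hp : ∀ x y, G.Adj x y → p x → p y) :
    ∀ {k : ℕ} {u v : V}, HasPath G k u v → p u → p v
  | 0, _, _, h, hu => (show _ = _ from h) ▸ hu
  | _ + 1, _, _, ⟨_, hw, h⟩, hu => HasPath.invariant hp h (hp _ _ hw hu)

theorem HasPath.le_add {G : Digraph V} {f : V → ℕ} (hf : ∀ x y, G.Adj x y → f y ≤ f x + 1) :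
    ∀ {k : ℕ} {u v : V}, HasPath G k u v → f v ≤ f u + k
  | 0, _, _, h => (show _ = _ from h) ▸ le_rfl
  | _ + 1, _, _, ⟨w, hw, h⟩ => by
    have h1 := HasPath.le_add hf h
    have h2 := hf _ _ hw
    omega

theorem hasPath_induce_iff {G : Digraph V} {C : Set V} (hC : ∀ x ∈ C, ∀ y, G.Adj x y → y ∈ C)
    (k : ℕ) (u v : C) : HasPath (induce G C) k u v ↔ HasPath G k u v := by
  induction k generalizing u with
  | zero => exact Subtype.ext_iff
  | succ k ih =>
    constructor
    · rintro ⟨w, hw, h⟩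
      exact ⟨w, hw, (ih w).1 h⟩
    · rintro ⟨w, hw, h⟩
      exact ⟨⟨w, hC _ u.2 _ hw⟩, hw, (ih ⟨w, hC _ u.2 _ hw⟩).2 h⟩

end Paths

/-- The disjoint union of a transitive chain on the vertices below `a`, with loops at the vertices
in `L`, and a ladder on the other vertices, with all edges to the vertices that are not larger and
an edge from `i` to `i + 1` unless `i ∈ M`. -/
def chainLadder (n a : ℕ) (L M : Set ℕ) : Digraph (Fin n) where
  Adj i j := (i.1 < a ∧ j.1 < a ∧ (i.1 < j.1 ∨ i.1 = j.1 ∧ i.1 ∈ L)) ∨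
    (a ≤ i.1 ∧ a ≤ j.1 ∧ (j.1 ≤ i.1 ∨ j.1 = i.1 + 1 ∧ i.1 ∉ M))

/-! ### The hidden edges: what an operation sees and how the answer changes. -/

section ChainLadder

variable {n a : ℕ} {L M : Set ℕ}

theorem chainLadder_adj (i j : Fin n) : (chainLadder n a L M).Adj i j ↔
    (i.1 < a ∧ j.1 < a ∧ (i.1 < j.1 ∨ i.1 = j.1 ∧ i.1 ∈ L)) ∨
    (a ≤ i.1 ∧ a ≤ j.1 ∧ (j.1 ≤ i.1 ∨ j.1 = i.1 + 1 ∧ i.1 ∉ M)) := Iff.rfl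

/-- The loop can only add `k` to the answer, and `k` is there already if `S` contains a later chain
vertex. -/
theorem pre_loop_ne {k : ℕ} {S : Set (Fin n)}
    (h : Pre (chainLadder n a {k} M) S ≠ Pre (chainLadder n a ∅ M) S) :
    (∃ s ∈ S, s.1 = k ∧ k < a) ∧ ∀ s ∈ S, s.1 < a → s.1 ≤ k := by
  by_contra hc
  refine h (Set.ext fun v => ⟨?_, ?_⟩)
  · rintro ⟨s, hs, h | h⟩
    · by_cases hvs : v.1 < s.1
      · exact ⟨s, hs, Or.inl ⟨h.1, h.2.1, Or.inl hvs⟩⟩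
      · have hv : v.1 = s.1 ∧ v.1 = k := by
          rcases h.2.2 with h' | h'
          · exact absurd h' hvs
          · exact h'
        rw [not_and] at hc
        have := hc ⟨s, hs, by omega, by omega⟩
        push Not at this
        obtain ⟨u, hu, hua, huk⟩ := this
        exact ⟨u, hu, Or.inl ⟨h.1, hua, Or.inl (by omega)⟩⟩
    · exact ⟨s, hs, Or.inr h⟩
  · rintro ⟨s, hs, h⟩
    refine ⟨s, hs, ?_⟩
    rw [chainLadder_adj] at h ⊢
    simp only [Set.mem_empty_iff_false, and_false, or_false] at h
    tauto

theorem post_loop_ne {k : ℕ} {S : Set (Fin n)}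
    (h : Post (chainLadder n a {k} M) S ≠ Post (chainLadder n a ∅ M) S) :
    (∃ s ∈ S, s.1 = k ∧ k < a) ∧ ∀ s ∈ S, s.1 < a → k ≤ s.1 := by
  by_contra hc
  refine h (Set.ext fun v => ⟨?_, ?_⟩)
  · rintro ⟨s, hs, h | h⟩
    · by_cases hvs : s.1 < v.1
      · exact ⟨s, hs, Or.inl ⟨h.1, h.2.1, Or.inl hvs⟩⟩
      · have hv : s.1 = v.1 ∧ s.1 = k := by
          rcases h.2.2 with h' | h'
          · exact absurd h' hvs
          · exact h'
        rw [not_and] at hc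
        have := hc ⟨s, hs, by omega, by omega⟩
        push Not at this
        obtain ⟨u, hu, hua, huk⟩ := this
        exact ⟨u, hu, Or.inl ⟨hua, h.2.1, Or.inl (by omega)⟩⟩
    · exact ⟨s, hs, Or.inr h⟩
  · rintro ⟨s, hs, h⟩
    refine ⟨s, hs, ?_⟩
    rw [chainLadder_adj] at h ⊢
    simp only [Set.mem_empty_iff_false, and_false, or_false] at h
    tauto

/-- The deletion can only remove `k` from the answer, and a ladder vertex of `S` at or below `k`
keeps it there through a backward edge or the loop at `k`. -/
theorem pre_gap_ne {k : ℕ} {S : Set (Fin n)}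
    (h : Pre (chainLadder n a L {k}) S ≠ Pre (chainLadder n a L ∅) S) :
    (∃ s ∈ S, s.1 = k + 1 ∧ a ≤ k) ∧ ∀ s ∈ S, a ≤ s.1 → k + 1 ≤ s.1 := by
  by_contra hc
  refine h (Set.ext fun v => ⟨?_, ?_⟩)
  · rintro ⟨s, hs, h⟩
    refine ⟨s, hs, ?_⟩
    rw [chainLadder_adj] at h ⊢
    simp only [Set.mem_empty_iff_false, not_false_eq_true, and_true]
    tauto
  · rintro ⟨s, hs, h | h⟩
    · exact ⟨s, hs, Or.inl h⟩
    · by_cases hvk : v.1 = k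
      · by_cases hsv : s.1 ≤ v.1
        · exact ⟨s, hs, Or.inr ⟨h.1, h.2.1, Or.inl hsv⟩⟩
        · rw [not_and] at hc
          have := hc ⟨s, hs, by omega, by omega⟩
          push Not at this
          obtain ⟨u, hu, hua, huk⟩ := this
          exact ⟨u, hu, Or.inr ⟨h.1, hua, Or.inl (by omega)⟩⟩
      · exact ⟨s, hs, Or.inr ⟨h.1, h.2.1, h.2.2.imp id fun h' => ⟨h'.1, hvk⟩⟩⟩

theorem post_gap_ne {k : ℕ} {S : Set (Fin n)}
    (h : Post (chainLadder n a L {k}) S ≠ Post (chainLadder n a L ∅) S) :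
    (∃ s ∈ S, s.1 = k ∧ a ≤ k) ∧ ∀ s ∈ S, a ≤ s.1 → s.1 ≤ k := by
  by_contra hc
  refine h (Set.ext fun v => ⟨?_, ?_⟩)
  · rintro ⟨s, hs, h⟩
    refine ⟨s, hs, ?_⟩
    rw [chainLadder_adj] at h ⊢
    simp only [Set.mem_empty_iff_false, not_false_eq_true, and_true]
    tauto
  · rintro ⟨s, hs, h | h⟩
    · exact ⟨s, hs, Or.inl h⟩
    · by_cases hsk : s.1 = k
      · by_cases hvs : v.1 ≤ s.1
        · exact ⟨s, hs, Or.inr ⟨h.1, h.2.1, Or.inl hvs⟩⟩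
        · rw [not_and] at hc
          have := hc ⟨s, hs, by omega, by omega⟩
          push Not at this
          obtain ⟨u, hu, hua, huk⟩ := this
          exact ⟨u, hu, Or.inr ⟨hua, h.2.1, Or.inl (by omega)⟩⟩
      · exact ⟨s, hs, Or.inr ⟨h.1, h.2.1, h.2.2.imp id fun h' => ⟨h'.1, hsk⟩⟩⟩

theorem not_buchiWinning_chain (T : Finset (Fin n)) (s : Fin n) (hs : s.1 < a) :
    ¬ BuchiWinning (chainLadder n a ∅ M) T s := by
  rintro ⟨p, h0, hp, -⟩
  -- Without loops the chain positions strictly increase, which is impossible beyond `a` steps.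
  have hlt : ∀ i, i ≤ (p i).1 ∧ (p i).1 < a := by
    intro i
    induction i with
    | zero => rw [h0]; exact ⟨Nat.zero_le _, hs⟩
    | succ i ih =>
      have := hp i
      rw [chainLadder_adj] at this
      simp only [Set.mem_empty_iff_false, and_false, or_false] at this
      omega
  have := hlt a
  omega

theorem buchiWinning_loop {T : Finset (Fin n)} {s k : Fin n} (hk : k.1 < a) (hsk : s.1 ≤ k.1)
    (hT : k ∈ T) : BuchiWinning (chainLadder n a {k.1} M) T s := by
  refine ⟨fun i => if i = 0 then s else k, rfl, fun i => ?_, k, hT, ?_⟩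
  · rcases hsk.lt_or_eq with h | h
    · by_cases hi : i = 0
      · simp [hi, chainLadder_adj, h, hk, h.trans hk]
      · simp [hi, chainLadder_adj, hk]
    · obtain rfl := Fin.ext h
      simp [chainLadder_adj, hk]
  · refine Eventually.frequently ?_
    filter_upwards [eventually_ge_atTop 1] with i hi
    simp [Nat.one_le_iff_ne_zero.1 hi]

theorem buchiWinning_ladder {T : Finset (Fin n)} {s t : Fin n} (hs : s.1 = a) (ht : t.1 + 1 = n)
    (hT : t ∈ T) : BuchiWinning (chainLadder n a L ∅) T s := by
  have := s.2
  refine ⟨fun i => ⟨min (a + i) t.1, by omega⟩, Fin.ext (by simp; omega), fun i => ?_, t, hT, ?_⟩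
  · rw [chainLadder_adj]
    simp only [Set.mem_empty_iff_false, not_false_eq_true, and_true]
    omega
  · refine Eventually.frequently ?_
    filter_upwards [eventually_ge_atTop n] with i hi
    exact Fin.ext (by simp; omega)

/-- Once the edge out of `k` is gone, the vertices from `a` to `k` are closed under edges and
contain no target. -/
theorem not_buchiWinning_gap {T : Finset (Fin n)} {s : Fin n} {k : ℕ} (hs : s.1 = a) (hk : a ≤ k)
    (hT : ∀ v ∈ T, v.1 < a ∨ k < v.1) : ¬ BuchiWinning (chainLadder n a L {k}) T s := by
  rintro ⟨p, h0, hp, v, hv, hfr⟩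
  have hinv : ∀ i, a ≤ (p i).1 ∧ (p i).1 ≤ k := by
    intro i
    induction i with
    | zero => rw [h0]; omega
    | succ i ih =>
      have := hp i
      rw [chainLadder_adj, Set.mem_singleton_iff] at this
      omega
  obtain ⟨i, hi⟩ := hfr.exists
  have h1 := hinv i
  have h2 := hT v hv
  rw [hi] at h1
  omega

/-! ### Cost bounds from the two families. -/

section Bounds

variable {Ω : Type*} [MeasurableSpace Ω] (μ : Measure Ω) [IsProbabilityMeasure μ]
  (A : SymbolicAlg Ω) {ε : ℝ} (hε : 0 ≤ ε) {𝒞 : Set Instance} (hA : A.SolvesBuchi μ ε 𝒞)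

include hε hA

theorem le_expectedOps_chain {t : ℕ} (hta : t ≤ a) (han : a ≤ n) (T : Finset (Fin n)) (s : Fin n)
    (hs : s.1 = 0) (ha : 0 < a) (hT : ∀ v : Fin n, v.1 < t → v ∈ T)
    (h𝒞 : ∀ L, (⟨n, chainLadder n a L ∅, T, s⟩ : Instance) ∈ 𝒞) :
    ENNReal.ofReal ((1 - 2 * ε) * t) ≤ A.expectedOps μ ⟨n, chainLadder n a ∅ ∅, T, s⟩ := by
  refine le_expectedOps_of_family μ A hε hA _ (fun i : Fin t => chainLadder n a {i.1} ∅) T s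
    ?_ ?_ (h𝒞 _) (fun i => h𝒞 _) ?_
  · intro S i j hi hj
    obtain ⟨⟨x, hx, hxi, hia⟩, hi'⟩ := pre_loop_ne hi
    obtain ⟨⟨y, hy, hyj, hja⟩, hj'⟩ := pre_loop_ne hj
    have h1 := hi' y hy (by omega)
    have h2 := hj' x hx (by omega)
    exact Fin.ext (by omega)
  · intro S i j hi hj
    obtain ⟨⟨x, hx, hxi, hia⟩, hi'⟩ := post_loop_ne hi
    obtain ⟨⟨y, hy, hyj, hja⟩, hj'⟩ := post_loop_ne hj
    have h1 := hi' y hy (by omega)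
    have h2 := hj' x hx (by omega)
    exact Fin.ext (by omega)
  · intro i
    have hi := i.2
    refine iff_of_true ?_ (not_buchiWinning_chain T s (by omega))
    exact buchiWinning_loop (k := ⟨i.1, by omega⟩) (by simp; omega) (by simp [hs]) (hT _ hi)

/-- A gap alters distances and components, so this serves for classes that restrict only `T` or
nothing at all. -/
theorem le_expectedOps_ladder {d : ℕ} (hn : n = a + d + 1) (T : Finset (Fin n)) (s : Fin n)
    (hs : s.1 = a) (hT : ∀ v : Fin n, v.1 = a + d → v ∈ T)
    (hT' : ∀ v ∈ T, v.1 < a ∨ v.1 = a + d)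
    (h𝒞 : ∀ M, (⟨n, chainLadder n a ∅ M, T, s⟩ : Instance) ∈ 𝒞) :
    ENNReal.ofReal ((1 - 2 * ε) * d) ≤ A.expectedOps μ ⟨n, chainLadder n a ∅ ∅, T, s⟩ := by
  refine le_expectedOps_of_family μ A hε hA _ (fun i : Fin d => chainLadder n a ∅ {a + i.1}) T s
    ?_ ?_ (h𝒞 _) (fun i => h𝒞 _) ?_
  · intro S i j hi hj
    obtain ⟨⟨x, hx, hxi, hia⟩, hi'⟩ := pre_gap_ne hi
    obtain ⟨⟨y, hy, hyj, hja⟩, hj'⟩ := pre_gap_ne hj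
    have h1 := hi' y hy (by omega)
    have h2 := hj' x hx (by omega)
    exact Fin.ext (by omega)
  · intro S i j hi hj
    obtain ⟨⟨x, hx, hxi, hia⟩, hi'⟩ := post_gap_ne hi
    obtain ⟨⟨y, hy, hyj, hja⟩, hj'⟩ := post_gap_ne hj
    have h1 := hi' y hy (by omega)
    have h2 := hj' x hx (by omega)
    exact Fin.ext (by omega)
  · intro i
    have hi := i.2
    refine iff_of_false (not_buchiWinning_gap hs (by omega) fun v hv => ?_) (not_not.2 ?_)
    · have := hT' v hv
      omega
    · exact buchiWinning_ladder (t := ⟨a + d, by omega⟩) hs hn.symm (hT _ rfl)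

end Bounds

/-! ### Diameters and strongly connected components of the construction. -/

theorem hasPath_chain {k : ℕ} {u v : Fin n} (h : HasPath (chainLadder n a L M) k u v)
    (hu : u.1 < a) : u.1 ≤ v.1 ∧ v.1 < a :=
  h.invariant (p := fun x => u.1 ≤ x.1 ∧ x.1 < a)
    (fun x y hxy hx => by rw [chainLadder_adj] at hxy; omega) ⟨le_rfl, hu⟩

theorem hasPath_ladder {k : ℕ} {u v : Fin n} (h : HasPath (chainLadder n a L M) k u v)
    (hu : a ≤ u.1) : a ≤ v.1 :=
  h.invariant (p := fun x => a ≤ x.1)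
    (fun x y hxy hx => by rw [chainLadder_adj] at hxy; omega) hu

theorem hasPath_ladder_up (k : ℕ) (u v : Fin n) (hu : a ≤ u.1) (huv : u.1 + k = v.1) :
    HasPath (chainLadder n a L ∅) k u v := by
  induction k generalizing u with
  | zero => exact Fin.ext huv
  | succ k ih =>
    have := v.2
    refine ⟨⟨u.1 + 1, by omega⟩, ?_, ih _ (by simp; omega) (by simp; omega)⟩
    exact Or.inr ⟨hu, Nat.le_succ_of_le hu, Or.inr ⟨rfl, fun h => h⟩⟩

theorem hasPath_one_of_adj {V : Type*} {G : Digraph V} {u v : V} (h : G.Adj u v) :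
    HasPath G 1 u v := ⟨v, h, rfl⟩

theorem exists_hasPath_ladder_le {d : ℕ} (hn : n = a + d + 1) (u v : Fin n) (hu : a ≤ u.1)
    (hv : a ≤ v.1) : ∃ j ≤ d, HasPath (chainLadder n a L ∅) j u v := by
  have := u.2
  have := v.2
  rcases le_or_gt u.1 v.1 with h | h
  · exact ⟨v.1 - u.1, by omega, hasPath_ladder_up _ u v hu (by omega)⟩
  · exact ⟨1, by omega, hasPath_one_of_adj (Or.inr ⟨hu, hv, Or.inl h.le⟩)⟩

theorem isDist_ladder {d : ℕ} (hn : n = a + d + 1) :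
    IsDist (chainLadder n a L ∅) ⟨a, by omega⟩ ⟨a + d, by omega⟩ d := by
  refine ⟨hasPath_ladder_up d _ _ le_rfl rfl, fun j hj => ?_⟩
  -- The height above the foot grows by at most 1 per edge; truncated subtraction makes it 0 on the
  -- chain.
  have := HasPath.le_add (f := fun x : Fin n => x.1 - a)
    (fun x y hxy => by rw [chainLadder_adj] at hxy; omega) hj
  simp only at this
  omega

theorem diam_chain (hn : 2 ≤ n) : diam (chainLadder n n L M) = 1 := by
  refine diam_eq ⟨⟨0, by omega⟩, ⟨1, by omega⟩, hasPath_one_of_adj ?_, ?_⟩ fun u v k h => ?_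
  · rw [chainLadder_adj]
    simp only
    omega
  · rintro (_ | j) hj
    · exact absurd (Fin.ext_iff.1 (show _ = _ from hj)) (by simp)
    · omega
  · have := hasPath_chain h u.2
    rcases this.1.lt_or_eq with h' | h'
    · exact ⟨1, le_rfl, hasPath_one_of_adj (Or.inl ⟨u.2, v.2, Or.inl h'⟩)⟩
    · exact ⟨0, Nat.zero_le _, Fin.ext h'⟩

/-- The chain can contribute distance 1, hence the condition `hd`. -/
theorem diam_chainLadder {d : ℕ} (hn : n = a + d + 1) (hd : 1 ≤ d ∨ a = 0) :
    diam (chainLadder n a L ∅) = d := by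
  refine diam_eq ⟨_, _, isDist_ladder hn⟩ fun u v k h => ?_
  rcases lt_or_ge u.1 a with hu | hu
  · have := hasPath_chain h hu
    rcases this.1.lt_or_eq with h' | h'
    · exact ⟨1, by omega, hasPath_one_of_adj (Or.inl ⟨hu, this.2, Or.inl h'⟩)⟩
    · exact ⟨0, Nat.zero_le _, Fin.ext h'⟩
  · exact exists_hasPath_ladder_le hn u v hu (hasPath_ladder h hu)

theorem mem_sccOf_self {V : Type*} (G : Digraph V) (v : V) : v ∈ sccOf G v := ⟨⟨0, rfl⟩, ⟨0, rfl⟩⟩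

theorem sccOf_chain {v : Fin n} (hv : v.1 < a) : sccOf (chainLadder n a L M) v = {v} := by
  refine Set.eq_singleton_iff_unique_mem.2 ⟨mem_sccOf_self _ _, ?_⟩
  rintro u ⟨⟨k, hk⟩, ⟨l, hl⟩⟩
  have h1 := hasPath_chain hl hv
  have h2 := hasPath_chain hk h1.2
  exact Fin.ext (by omega)

theorem sccOf_ladder {v : Fin n} (hv : a ≤ v.1) :
    sccOf (chainLadder n a L ∅) v = {u | a ≤ u.1} := by
  have := v.2
  ext u
  constructor
  · rintro ⟨-, ⟨l, hl⟩⟩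
    exact hasPath_ladder hl hv
  · intro hu
    have hn : n = a + (n - a - 1) + 1 := by omega
    obtain ⟨j, -, hj⟩ := exists_hasPath_ladder_le (L := L) hn u v hu hv
    obtain ⟨k, -, hk⟩ := exists_hasPath_ladder_le (L := L) hn v u hv hu
    exact ⟨⟨j, hj⟩, ⟨k, hk⟩⟩

theorem diam_induce_sccOf_chain {v : Fin n} (hv : v.1 < a) :
    diam (induce (chainLadder n a L M) (sccOf (chainLadder n a L M) v)) = 0 := by
  rw [sccOf_chain hv]
  exact diam_eq_zero_of_subsingleton _

theorem diam_induce_sccOf_ladder {d : ℕ} (hn : n = a + d + 1) {v : Fin n} (hv : a ≤ v.1) :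
    diam (induce (chainLadder n a L ∅) (sccOf (chainLadder n a L ∅) v)) = d := by
  rw [sccOf_ladder hv]
  have hC : ∀ x ∈ {u : Fin n | a ≤ u.1}, ∀ y, (chainLadder n a L ∅).Adj x y →
      y ∈ {u : Fin n | a ≤ u.1} := fun x hx y hxy => hasPath_ladder (hasPath_one_of_adj hxy) hx
  refine diam_eq ⟨⟨⟨a, by omega⟩, le_refl a⟩, ⟨⟨a + d, by omega⟩, Nat.le_add_right _ _⟩, ?_⟩ ?_
  · simpa only [IsDist, hasPath_induce_iff hC] using isDist_ladder hn
  · intro u v k _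
    simpa only [hasPath_induce_iff hC] using exists_hasPath_ladder_le hn u.1 v.1 u.2 v.2

/-- A set of representatives of the strongly connected components determines their number and the
sum of their diameters. -/
theorem ncard_sccs_and_sumSccDiam {V : Type*} (G : Digraph V) {p : ℕ} (r : Fin p → V)
    (hinj : ∀ i j, r j ∈ sccOf G (r i) → i = j) (hsurj : ∀ v, ∃ i, sccOf G (r i) = sccOf G v) :
    (sccs G).ncard = p ∧ sumSccDiam G = ∑ i, diam (induce G (sccOf G (r i))) := by
  have hf : Function.Injective fun i => sccOf G (r i) := fun i j hij =>
    hinj i j (by simp only at hij; rw [hij]; exact mem_sccOf_self _ _)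
  have hr : sccs G = Set.range fun i => sccOf G (r i) := by
    refine Set.Subset.antisymm ?_ ?_
    · rintro _ ⟨v, rfl⟩
      exact hsurj v
    · rintro _ ⟨i, rfl⟩
      exact ⟨r i, rfl⟩
  refine ⟨?_, ?_⟩
  · rw [hr, ← Set.image_univ, Set.ncard_image_of_injective _ hf, Set.ncard_univ, Nat.card_fin]
  · rw [sumSccDiam, hr, finsum_mem_range hf, finsum_eq_sum_of_fintype]

theorem ncard_sccs_and_sumSccDiam_chain :
    (sccs (chainLadder n n L M)).ncard = n ∧ sumSccDiam (chainLadder n n L M) = 0 := by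
  obtain ⟨h1, h2⟩ := ncard_sccs_and_sumSccDiam (chainLadder n n L M) id
    (fun i j h => by rw [id, id, sccOf_chain i.2] at h; exact (Set.mem_singleton_iff.1 h).symm)
    (fun v => ⟨v, rfl⟩)
  exact ⟨h1, h2.trans (Finset.sum_eq_zero fun i _ => diam_induce_sccOf_chain i.2)⟩

theorem ncard_sccs_and_sumSccDiam_chainLadder {d : ℕ} (hn : n = a + d + 1) :
    (sccs (chainLadder n a L ∅)).ncard = a + 1 ∧ sumSccDiam (chainLadder n a L ∅) = d := by
  have hinj : ∀ i j : Fin (a + 1), (⟨j.1, by omega⟩ : Fin n) ∈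
      sccOf (chainLadder n a L ∅) ⟨i.1, by omega⟩ → i = j := by
    intro i j h
    have hj := j.2
    rcases lt_or_ge i.1 a with hi | hi
    · rw [sccOf_chain (by simpa using hi)] at h
      exact Fin.ext (Fin.ext_iff.1 (Set.mem_singleton_iff.1 h)).symm
    · rw [sccOf_ladder (by simpa using hi)] at h
      have : a ≤ j.1 := h
      exact Fin.ext (by omega)
  have hsurj : ∀ v, ∃ i : Fin (a + 1), sccOf (chainLadder n a L ∅) ⟨i.1, by omega⟩ =
      sccOf (chainLadder n a L ∅) v := by
    intro v
    rcases lt_or_ge v.1 a with hv | hv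
    · exact ⟨⟨v.1, by omega⟩, rfl⟩
    · exact ⟨Fin.last a, by rw [sccOf_ladder (by simp), sccOf_ladder hv]⟩
  obtain ⟨h1, h2⟩ := ncard_sccs_and_sumSccDiam (chainLadder n a L ∅)
    (fun i : Fin (a + 1) => (⟨i.1, by omega⟩ : Fin n)) hinj hsurj
  refine ⟨h1, h2.trans ?_⟩
  rw [Fin.sum_univ_castSucc, Finset.sum_eq_zero fun i _ => diam_induce_sccOf_chain (by simp),
    zero_add]
  exact diam_induce_sccOf_ladder hn (by simp)

end ChainLadder

theorem card_filter_val_lt {n t : ℕ} (h : t ≤ n) :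
    (Finset.univ.filter fun v : Fin n => v.1 < t).card = t := by
  rw [Fin.card_filter_val_lt, min_eq_right h]

/-- The vertices below `m` together with the vertex `l`. -/
theorem card_filter_val_lt_or_eq {n m l : ℕ} (hml : m ≤ l) (hl : l < n) :
    (Finset.univ.filter fun v : Fin n => v.1 < m ∨ v.1 = l).card = m + 1 := by
  have : (Finset.univ.filter fun v : Fin n => v.1 < m ∨ v.1 = l) =
      insert (⟨l, hl⟩ : Fin n) (Finset.univ.filter fun v : Fin n => v.1 < m) := by
    ext v
    simp [Fin.ext_iff, or_comm]
  rw [this, Finset.card_insert_of_notMem (by simpa using hml), card_filter_val_lt (by omega)]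

end SymbolicBuchi

/-! ### Choice of the instances. -/

theorem theorem3p4 (ε : ℝ) (hε₀ : 0 ≤ ε) (hε : ε < 1 / 2) :
    ∃ c : ℝ, 0 < c ∧
      ∀ (Ω : Type*) [MeasurableSpace Ω] (μ : Measure Ω) [IsProbabilityMeasure μ] (A : SymbolicAlg Ω),
        -- `Ω(n)`, even for diameter 1
        (A.SolvesBuchi μ ε {I | diam I.G = 1} → ∀ n : ℕ, 2 ≤ n →
          ∃ I : Instance, I.n = n ∧ diam I.G = 1 ∧
            ENNReal.ofReal (c * n) ≤ A.expectedOps μ I) ∧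
        -- `Ω(D)`, even for a single target vertex
        (A.SolvesBuchi μ ε {I | I.T.card = 1} → ∀ d : ℕ,
          ∃ I : Instance, I.T.card = 1 ∧ diam I.G = d ∧
            ENNReal.ofReal (c * d) ≤ A.expectedOps μ I) ∧
        -- `Ω(|T|)`, even for diameter 1
        (A.SolvesBuchi μ ε {I | diam I.G = 1} → ∀ t : ℕ,
          ∃ I : Instance, I.T.card = t ∧ diam I.G = 1 ∧
            ENNReal.ofReal (c * t) ≤ A.expectedOps μ I) ∧
        -- `Ω(|T| + D)`
        (A.SolvesBuchi μ ε Set.univ → ∀ t d : ℕ, 1 ≤ t → 1 ≤ d →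
          ∃ I : Instance, I.T.card = t ∧ diam I.G = d ∧
            ENNReal.ofReal (c * (t + d)) ≤ A.expectedOps μ I) ∧
        -- `Ω(|SCCs(G)| + ∑_C D_C)`
        (A.SolvesBuchi μ ε Set.univ → ∀ p q : ℕ, 1 ≤ p →
          ∃ I : Instance, (sccs I.G).ncard = p ∧ sumSccDiam I.G = q ∧
            ENNReal.ofReal (c * (p + q)) ≤ A.expectedOps μ I) := by
  obtain ⟨δ, hδ⟩ : ∃ δ, δ = 1 - 2 * ε := ⟨_, rfl⟩
  have hδ0 : 0 < δ := by linarith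
  -- A sum is at most twice its larger term. The worst case is `m + 1 + q ≤ 3 * max m q` for `q ≥
  -- 1`, so 4 leaves room.
  refine ⟨δ / 4, by positivity, fun Ω _ μ _ A => ⟨?_, ?_, ?_, ?_, ?_⟩⟩
  · intro hA n hn
    refine ⟨⟨n, chainLadder n n ∅ ∅, Finset.univ, ⟨0, by omega⟩⟩, rfl, diam_chain hn, ?_⟩
    refine le_trans (ENNReal.ofReal_le_ofReal ?_) (le_expectedOps_chain μ A hε₀ hA le_rfl le_rfl _ _
      rfl (by omega) (fun v _ => Finset.mem_univ v) fun L => diam_chain hn)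
    rw [← hδ]
    gcongr
    linarith
  · intro hA d
    have hT : (Finset.univ.filter fun v : Fin (0 + d + 1) => v.1 < 0 ∨ v.1 = 0 + d).card = 1 :=
      card_filter_val_lt_or_eq (by omega) (by omega)
    refine ⟨⟨0 + d + 1, chainLadder (0 + d + 1) 0 ∅ ∅, _, ⟨0, by omega⟩⟩, hT,
      diam_chainLadder rfl (Or.inr rfl), ?_⟩
    refine le_trans (ENNReal.ofReal_le_ofReal ?_) (le_expectedOps_ladder μ A hε₀ hA rfl _ _
      rfl (by simp) (by simp) fun M => hT)
    rw [← hδ]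
    gcongr
    linarith
  · intro hA t
    -- Two extra vertices keep the diameter at 1 even when `t ≤ 1`.
    refine ⟨⟨t + 2, chainLadder (t + 2) (t + 2) ∅ ∅, Finset.univ.filter fun v => v.1 < t,
      ⟨0, by omega⟩⟩, card_filter_val_lt (by omega), diam_chain (by omega), ?_⟩
    refine le_trans (ENNReal.ofReal_le_ofReal ?_) (le_expectedOps_chain μ A hε₀ hA (Nat.le_add_right t 2) le_rfl
      _ _ rfl (Nat.succ_pos _) (by simp) fun L => diam_chain (by omega))
    rw [← hδ]
    gcongr
    linarith
  · intro hA t d ht hd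
    rcases le_total d t with h | h
    · refine ⟨⟨t + d + 1, chainLadder (t + d + 1) t ∅ ∅, Finset.univ.filter fun v => v.1 < t,
        ⟨0, by omega⟩⟩, card_filter_val_lt (by omega), diam_chainLadder rfl (Or.inl hd), ?_⟩
      refine le_trans (ENNReal.ofReal_le_ofReal ?_) (le_expectedOps_chain μ A hε₀ hA le_rfl
        (by omega) _ _ rfl (by omega) (by simp) fun L => Set.mem_univ _)
      have : (d : ℝ) ≤ t := by exact_mod_cast h
      rw [← hδ]
      nlinarith
    -- The `m = t - 1` chain vertices, unreachable from the foot of the ladder, pad `T` to size `t`.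
    · obtain ⟨m, rfl⟩ := Nat.exists_eq_add_of_le' ht
      refine ⟨⟨m + d + 1, chainLadder (m + d + 1) m ∅ ∅,
        Finset.univ.filter fun v => v.1 < m ∨ v.1 = m + d, ⟨m, by omega⟩⟩,
        card_filter_val_lt_or_eq (by omega) (by omega), diam_chainLadder rfl (Or.inl hd), ?_⟩
      refine le_trans (ENNReal.ofReal_le_ofReal ?_) (le_expectedOps_ladder μ A hε₀ hA rfl _ _
        rfl (by simp +contextual) (by simp) fun M => Set.mem_univ _)
      have : ((m + 1 : ℕ) : ℝ) ≤ d := by exact_mod_cast h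
      rw [← hδ]
      nlinarith
  · intro hA p q hp
    -- For `q = 0` all `p` components must be chain vertices: spending one on a trivial ladder would
    -- give the bound 0 at `p = 1`.
    rcases Nat.eq_zero_or_pos q with rfl | hq
    · refine ⟨⟨p, chainLadder p p ∅ ∅, Finset.univ, ⟨0, by omega⟩⟩,
        ncard_sccs_and_sumSccDiam_chain.1, ncard_sccs_and_sumSccDiam_chain.2, ?_⟩
      refine le_trans (ENNReal.ofReal_le_ofReal ?_) (le_expectedOps_chain μ A hε₀ hA le_rfl le_rfl
        _ _ rfl (by omega) (fun v _ => Finset.mem_univ v) fun L => Set.mem_univ _)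
      have : (0 : ℝ) ≤ p := by positivity
      rw [← hδ]
      push_cast
      nlinarith
    · obtain ⟨m, rfl⟩ := Nat.exists_eq_add_of_le' hp
      have hq' : (1 : ℝ) ≤ q := by exact_mod_cast hq
      rcases le_total q m with h | h
      · refine ⟨⟨m + q + 1, chainLadder (m + q + 1) m ∅ ∅, Finset.univ.filter fun v => v.1 < m,
          ⟨0, by omega⟩⟩, (ncard_sccs_and_sumSccDiam_chainLadder rfl).1,
          (ncard_sccs_and_sumSccDiam_chainLadder rfl).2, ?_⟩
        refine le_trans (ENNReal.ofReal_le_ofReal ?_) (le_expectedOps_chain μ A hε₀ hA le_rfl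
          (by omega) _ _ rfl (by omega) (by simp) fun L => Set.mem_univ _)
        have : (q : ℝ) ≤ m := by exact_mod_cast h
        rw [← hδ]
        push_cast
        nlinarith
      · refine ⟨⟨m + q + 1, chainLadder (m + q + 1) m ∅ ∅,
          Finset.univ.filter fun v => v.1 = m + q, ⟨m, by omega⟩⟩,
          (ncard_sccs_and_sumSccDiam_chainLadder rfl).1,
          (ncard_sccs_and_sumSccDiam_chainLadder rfl).2, ?_⟩
        refine le_trans (ENNReal.ofReal_le_ofReal ?_) (le_expectedOps_ladder μ A hε₀ hA rfl _ _
          rfl (by simp) (by simp +contextual) fun M => Set.mem_univ _)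
        have : (m : ℝ) ≤ q := by exact_mod_cast h
        rw [← hδ]
        push_cast
        nlinarith
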